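/- **Theorem.** Let $G_1$ be a connected simple graph (finite or infinite, with non-empty vertex set), and let $P_2$ be the path graph with two vertices and one edge. If $G_1$ is not hyperbolic, then the direct product $G_1\times P_2$ is not hyperbolic. Here the direct product $G\times H$ has vertex set $V(G)\times V(H)$, and $(u_1,v_1)$, $(u_2,v_2)$ are adjacent if and only if $u_1u_2\in E(G)$ and $v_1v_2\in E(H)$. A graph is viewed as a metric space whose points are the vertices and the interior points of the edges: each edge is identified with the interval $[0,1]$, and the distance between two points is the infimum of the lengths of the paths joining them ($\infty$ if they lie in different connected components). A geodesic joining $x$ and $y$ is an isometric image of a compact interval with endpoints mapped to $x$ and $y$. A geodesic triangle is the union of three geodesics $[xy]$, $[yz]$, $[zx]$; it is $\delta$-thin if each of its sides is contained in the (closed) $\delta$-neighborhood of the union of the other two. A graph is hyperbolic if there is a constant $\delta\ge 0$ such that every geodesic triangle in each of its connected components is $\delta$-thin. -/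

import Mathlib

open scoped ENNReal NNReal

noncomputable section

/-! ### The direct product of graphs -/

/-- The direct product of two graphs: `(u₁, v₁)` and `(u₂, v₂)` are adjacent iff `u₁ u₂` is an edge
of the first factor and `v₁ v₂` is an edge of the second factor. -/
def directProduct {V W : Type*} (G : SimpleGraph V) (H : SimpleGraph W) :
    SimpleGraph (V × W) where
  Adj a b := G.Adj a.1 b.1 ∧ H.Adj a.2 b.2
  symm := ⟨fun _ _ h => ⟨h.1.symm, h.2.symm⟩⟩
  loopless := ⟨fun _ h => G.irrefl h.1⟩

/-! ### A graph as a metric space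

The points of the metric graph of `G` are the vertices and the interior points of the edges. They are
given in barycentric coordinates: the vertex `u` is the function `Pi.single u 1 : V → ℝ`, and the
edge `u v` is the segment joining `Pi.single u 1` and `Pi.single v 1`. -/

open Classical in
/-- The closed edge joining `u` and `v`; for `u = v` it is the single vertex `u`. -/
def edgeSegment {V : Type*} (u v : V) : Set (V → ℝ) :=
  segment ℝ (Pi.single u (1 : ℝ)) (Pi.single v (1 : ℝ))

/-- The points of the metric graph of `G`: they are the vertices (case `u = v`) and the points of
the edges (case `G.Adj u v`). -/
structure MetricGraph {V : Type*} (G : SimpleGraph V) where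
  /-- The barycentric coordinates of the point. -/
  coord : V → ℝ
  mem_edge : ∃ u v : V, (u = v ∨ G.Adj u v) ∧ coord ∈ edgeSegment u v

namespace MetricGraph

variable {V : Type*} {G : SimpleGraph V}

open Classical in
/-- A vertex of `G`, as a point of the metric graph. -/
def vertex (G : SimpleGraph V) (u : V) : MetricGraph G :=
  ⟨Pi.single u 1, u, u, Or.inl rfl, left_mem_segment ℝ _ _⟩

/-- Two points lie on a common closed edge (or are the same vertex). -/
def OnCommonEdge (x y : MetricGraph G) : Prop :=
  ∃ u v : V, (u = v ∨ G.Adj u v) ∧ x.coord ∈ edgeSegment u v ∧ y.coord ∈ edgeSegment u v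

/-- The length of the piece of edge between two points of a common edge, where each edge is a copy
of the interval `[0, 1]`: the points with coordinates `(1 - s, s)` and `(1 - t, t)` on an edge are
at distance `|s - t|`. -/
def stepLength (x y : MetricGraph G) : ℝ≥0∞ :=
  ⨆ w : V, edist (x.coord w) (y.coord w)

/-- `PathOfLength x y r`: there is a path from `x` to `y` of length `r`, which is a finite
concatenation of pieces of edges. -/
inductive PathOfLength : MetricGraph G → MetricGraph G → ℝ≥0∞ → Prop
  | nil (x : MetricGraph G) : PathOfLength x x 0
  | cons {x y z : MetricGraph G} {r : ℝ≥0∞} (h : OnCommonEdge x y) (p : PathOfLength y z r) :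
      PathOfLength x z (stepLength x y + r)

theorem OnCommonEdge.symm {x y : MetricGraph G} (h : OnCommonEdge x y) : OnCommonEdge y x := by
  obtain ⟨u, v, huv, hx, hy⟩ := h
  exact ⟨u, v, huv, hy, hx⟩

theorem stepLength_comm (x y : MetricGraph G) : stepLength x y = stepLength y x := by
  simp only [stepLength, edist_comm]

theorem PathOfLength.append {x y z : MetricGraph G} {r s : ℝ≥0∞} (p : PathOfLength x y r)
    (q : PathOfLength y z s) : PathOfLength x z (r + s) := by
  induction p with
  | nil x => simpa using q
  | cons h p ih => rw [add_assoc]; exact PathOfLength.cons h (ih q)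

theorem PathOfLength.symm {x y : MetricGraph G} {r : ℝ≥0∞} (p : PathOfLength x y r) :
    PathOfLength y x r := by
  induction p with
  | nil x => exact PathOfLength.nil x
  | @cons x y z r h p ih =>
    have hq : PathOfLength y x (stepLength y x + 0) := PathOfLength.cons h.symm (PathOfLength.nil x)
    rw [add_zero, stepLength_comm] at hq
    rw [add_comm]
    exact ih.append hq

/-- The distance between two points of the metric graph is the infimum of the lengths of the paths
joining them; it is `∞` for points in different connected components. -/
instance : PseudoEMetricSpace (MetricGraph G) where
  edist x y := ⨅ (r : ℝ≥0∞) (_ : PathOfLength x y r), r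
  edist_self x := le_antisymm (iInf₂_le 0 (PathOfLength.nil x)) bot_le
  edist_comm x y := le_antisymm
    (le_iInf₂ fun r p => iInf₂_le r p.symm) (le_iInf₂ fun r p => iInf₂_le r p.symm)
  edist_triangle x y z := by
    simp only [ENNReal.iInf_add, ENNReal.add_iInf]
    exact le_iInf₂ fun s q => le_iInf₂ fun r p => iInf₂_le (r + s) (p.append q)

end MetricGraph

/-! ### Geodesics, geodesic triangles and hyperbolicity -/

/-- The set `S` is (the image of) a geodesic joining `x` and `y`: it is the image of an isometric
map from a compact interval `[0, L]` that sends the endpoints to `x` and `y`. -/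
def IsGeodesic {X : Type*} [PseudoEMetricSpace X] (x y : X) (S : Set X) : Prop :=
  ∃ (L : ℝ) (γ : ℝ → X), 0 ≤ L ∧ γ 0 = x ∧ γ L = y ∧
    (∀ s ∈ Set.Icc 0 L, ∀ t ∈ Set.Icc 0 L, edist (γ s) (γ t) = edist s t) ∧
    S = γ '' Set.Icc 0 L

/-- The sets `A`, `B`, `C` are the sides of a geodesic triangle with vertices `x`, `y`, `z`. -/
structure IsGeodesicTriangle {X : Type*} [PseudoEMetricSpace X] (x y z : X) (A B C : Set X) :
    Prop where
  side_xy : IsGeodesic x y A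
  side_yz : IsGeodesic y z B
  side_zx : IsGeodesic z x C

/-- A triangle with sides `A`, `B`, `C` is `δ`-thin if each side is contained in the
`δ`-neighbourhood of the union of the two others. -/
def IsThin {X : Type*} [PseudoEMetricSpace X] (δ : ℝ≥0) (A B C : Set X) : Prop :=
  (∀ p ∈ A, Metric.infEDist p (B ∪ C) ≤ δ) ∧
  (∀ p ∈ B, Metric.infEDist p (C ∪ A) ≤ δ) ∧
  (∀ p ∈ C, Metric.infEDist p (A ∪ B) ≤ δ)

/-- `X` is `δ`-hyperbolic if every geodesic triangle of `X` is `δ`-thin. If `X` has several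
components (at infinite distance from each other), each geodesic triangle lies in one component, so
this says that every component is `δ`-hyperbolic. -/
def IsDeltaHyperbolic (X : Type*) [PseudoEMetricSpace X] (δ : ℝ≥0) : Prop :=
  ∀ (x y z : X) (A B C : Set X), IsGeodesicTriangle x y z A B C → IsThin δ A B C

/-- A graph is hyperbolic if its metric graph is `δ`-hyperbolic for some `δ ≥ 0`, i.e. if the
supremum of the hyperbolicity constants of its connected components is finite. -/
def IsHyperbolicGraph {V : Type*} (G : SimpleGraph V) : Prop :=
  ∃ δ : ℝ≥0, IsDeltaHyperbolic (MetricGraph G) δ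

end

/-! The proof is by contraposition, with Gromov's four-point condition on vertices as the
intermediary. Thin triangles in `G₁ × P₂` give this condition there (`VertexThin.fourPoint`), it
descends to `G₁` (`FourPoint.of_directProduct`), and on a connected graph it gives back thin
triangles (`FourPointSpace.isDeltaHyperbolic`).

The descent is the heart of the matter. `G₁ × P₂` is the bipartite double cover, with an involution
σ exchanging the sheets. Projection to `G₁` does not increase distances and geodesics lift, so the
only obstruction is that a lift may end on the wrong sheet. If no vertex is connected to its
σ-image, projection is isometric on each component. Otherwise take the midpoint `m` of a geodesic
from some `x` to `σ x`: the four-point condition with constant `k` gives `d(m, σ m) ≤ k + 1`, so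
distances to `m` agree with their projections up to `k + 1`. This suffices for the four-point
condition with base point `m.1`, and a change of base point makes it general. -/

/-! ### The four-point condition on the vertices of a graph -/

namespace SimpleGraph

variable {V : Type*} {G : SimpleGraph V}

/-- The four-point condition for the graph distance, on each connected component. -/
def FourPoint (G : SimpleGraph V) (k : ℕ) : Prop :=
  ∀ a b c e : V, G.Reachable a b → G.Reachable a c → G.Reachable a e →
    G.dist a c + G.dist b e ≤ max (G.dist a b + G.dist c e) (G.dist b c + G.dist a e) + k

/-- A discrete version of thin triangles: every vertex of a geodesic from `x` to `y` is close to a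
vertex on a geodesic joining `z` to `x` or to `y`. -/
def VertexThin (G : SimpleGraph V) (k : ℕ) : Prop :=
  ∀ x y z u : V, G.Reachable x y → G.Reachable x z → G.Reachable x u →
    G.dist x u + G.dist u y = G.dist x y →
    ∃ v, G.Reachable x v ∧ G.dist u v ≤ k ∧
      (G.dist y v + G.dist v z = G.dist y z ∨ G.dist x v + G.dist v z = G.dist x z)

theorem Walk.dist_getVert_add {u v : V} {p : G.Walk u v} (hp : p.length = G.dist u v) (i : ℕ) :
    G.dist u (p.getVert i) + G.dist (p.getVert i) v = G.dist u v := by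
  refine le_antisymm ?_ (Reachable.dist_triangle_left ⟨p.take i⟩ v)
  have h1 := dist_le (p.take i)
  have h2 := dist_le (p.drop i)
  rw [Walk.take_length] at h1
  rw [Walk.drop_length] at h2
  omega

theorem Walk.dist_getVert_succ_le {u v : V} (p : G.Walk u v) (i : ℕ) :
    G.dist (p.getVert i) (p.getVert (i + 1)) ≤ 1 := by
  rcases lt_or_ge i p.length with h | h
  · exact (dist_eq_one_iff_adj.2 (p.adj_getVert_succ h)).le
  · rw [p.getVert_of_length_le h, p.getVert_of_length_le (by omega), dist_self]
    exact zero_le_one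

/-- Some vertex `u` of a geodesic from `x` to `y` satisfies `d(w, u) ≤ (x|y)_w + 2k + 1`, with
`(x|y)_w` the Gromov product. Along the geodesic there is a place where closeness to the side `xw`
gives way to closeness to the side `yw`, and such a vertex works. -/
theorem VertexThin.exists_near {k : ℕ} (h : G.VertexThin k) {x y w : V} (hy : G.Reachable x y)
    (hw : G.Reachable x w) :
    ∃ u, G.Reachable x u ∧ G.dist x u + G.dist u y = G.dist x y ∧
      2 * G.dist w u + G.dist x y ≤ G.dist w x + G.dist w y + (4 * k + 2) := by
  obtain ⟨p, hp⟩ := hy.exists_walk_length_eq_dist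
  have hr : ∀ i, G.Reachable x (p.getVert i) := fun i => ⟨p.take i⟩
  by_contra! hcon
  -- If no vertex works, closeness to the side `xw` propagates from `x` all the way to `y`; then `y`
  -- itself is a suitable vertex.
  have key : ∀ i, ∃ v, G.Reachable x v ∧ G.dist (p.getVert i) v ≤ k ∧
      G.dist x v + G.dist v w = G.dist x w := by
    intro i
    induction i with
    | zero => exact ⟨x, .rfl, by simp, by simp⟩
    | succ i ih =>
      obtain ⟨v, hv, hiv, hxv⟩ := ih
      obtain ⟨v', hv', hiv', h' | h'⟩ :=
        h x y w (p.getVert (i + 1)) hy hw (hr _) (p.dist_getVert_add hp _)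
      · exfalso
        have h1 := hcon _ (hr i) (p.dist_getVert_add hp i)
        have h2 := p.dist_getVert_add hp i
        have h3 := p.dist_getVert_succ_le i
        have hri := hr i
        have hrs := hr (i + 1)
        generalize p.getVert i = s at *
        generalize p.getVert (i + 1) = t at *
        have h4 := ((hri.symm.trans hv).symm.dist_triangle_right x)
        have h5 := (hri.symm.trans hv).dist_triangle_left w
        have h6 := (hri.symm.trans hv').dist_triangle_left w
        have h7 := (hri.symm.trans hv').symm.dist_triangle_right y
        have h9 := G.dist_comm (u := w) (v := s)
        have h10 := G.dist_comm (u := w) (v := x)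
        have h11 := G.dist_comm (u := w) (v := y)
        have h12 := G.dist_comm (u := v) (v := s)
        have h13 := G.dist_comm (u := v') (v := s)
        have h14 := G.dist_comm (u := y) (v := s)
        have h15 : G.dist s v' ≤ G.dist s t + G.dist t v' :=
          Reachable.dist_triangle_left (hri.symm.trans hrs) v'
        omega
      · exact ⟨v', hv', hiv', h'⟩
  obtain ⟨v, hv, hiv, hxv⟩ := key p.length
  rw [p.getVert_length] at hiv
  have h1 := hcon y hy (by simp)
  have h2 := (hy.symm.trans hv).dist_triangle_left w
  have h3 := (hy.symm.trans hv).symm.dist_triangle_right x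
  have h4 := G.dist_comm (u := w) (v := y)
  have h5 := G.dist_comm (u := w) (v := x)
  have h6 := G.dist_comm (u := v) (v := y)
  omega

/-- Choose `u` between `x` and `z` nearly realizing the Gromov product at `w`, then `v` within `k`
of `u` on a side ending at `y`. The detour from `w` to `y` through `v` bounds `d(w, y)`; passing
from `u` to `v` adds `2k` to the `4k + 2` of `exists_near`. -/
theorem VertexThin.fourPoint {k : ℕ} (h : G.VertexThin k) : G.FourPoint (6 * k + 2) := by
  intro x w z y hw hz hy
  obtain ⟨u, hu, hxuz, hwu⟩ := h.exists_near hz hw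
  obtain ⟨v, hv, huv, hb⟩ := h x z y u hz hy hu hxuz
  have h1 := (hu.symm.trans hv).dist_triangle_right w
  have h2 := (hw.symm.trans hv).dist_triangle_left x
  have h3 := (hw.symm.trans hv).dist_triangle_left y
  have h4 := (hw.symm.trans hv).dist_triangle_left z
  have h5 := G.dist_comm (u := v) (v := x)
  have h6 := G.dist_comm (u := v) (v := z)
  have h7 := G.dist_comm (u := z) (v := y)
  have h8 := G.dist_comm (u := w) (v := x)
  omega

end SimpleGraph

/-! ### The four-point condition descends from the double cover -/

namespace SimpleGraph

variable {V : Type*} {G : SimpleGraph V}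

/-- Gromov's change of base point: if the four-point condition holds for all quadruples containing
a fixed vertex, then it holds with a doubled constant. -/
theorem FourPoint.of_base {k : ℕ} (f : V)
    (h : ∀ a b c : V,
      G.dist a c + G.dist b f ≤ max (G.dist a b + G.dist c f) (G.dist b c + G.dist a f) + k) :
    G.FourPoint (2 * k) := by
  intro a b c e _ _ _
  -- In Gromov products at `f`, these are four inequalities of the form `(a|c) ≥ min((a|b), (b|c)) -
  -- k/2`. The claim is `(a|c) + (b|e) ≥ min((a|b) + (c|e), (b|c) + (a|e)) - k`.
  have h1 := h a b c
  have h2 := h a e c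
  have h3 := h b a e
  have h4 := h b c e
  have c1 := G.dist_comm (u := b) (v := a)
  have c2 := G.dist_comm (u := c) (v := e)
  have c3 := G.dist_comm (u := c) (v := b)
  have c4 := G.dist_comm (u := a) (v := e)
  rw [← max_add_add_right] at *
  simp only [le_max_iff] at *
  omega

/-- Exchanging the two sheets of the bipartite double cover. -/
def sheetSwap (x : V × Fin 2) : V × Fin 2 := (x.1, x.2.rev)

/-- The bipartite double cover of a graph. -/
abbrev doubleCover (G : SimpleGraph V) : SimpleGraph (V × Fin 2) := directProduct G (pathGraph 2)

theorem pathGraph_two_adj_iff {i j : Fin 2} : (pathGraph 2).Adj i j ↔ j = i.rev := by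
  rw [pathGraph_two_eq_top, top_adj]
  revert i j
  decide

theorem sheetSwap_adj {x y : V × Fin 2} (h : G.doubleCover.Adj x y) :
    G.doubleCover.Adj (sheetSwap x) (sheetSwap y) :=
  ⟨h.1, pathGraph_two_adj_iff.2 (congrArg Fin.rev (pathGraph_two_adj_iff.1 h.2))⟩

theorem exists_walk_sheetSwap {x y : V × Fin 2} (p : G.doubleCover.Walk x y) :
    ∃ q : G.doubleCover.Walk (sheetSwap x) (sheetSwap y), q.length = p.length := by
  induction p with
  | nil => exact ⟨.nil, rfl⟩
  | cons h p ih =>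
    obtain ⟨q, hq⟩ := ih
    exact ⟨.cons (sheetSwap_adj h) q, congrArg (· + 1) hq⟩

theorem sheetSwap_sheetSwap (x : V × Fin 2) : sheetSwap (sheetSwap x) = x := by
  simp [sheetSwap]

theorem Reachable.sheetSwap {x y : V × Fin 2} (h : G.doubleCover.Reachable x y) :
    G.doubleCover.Reachable (sheetSwap x) (sheetSwap y) := by
  obtain ⟨p⟩ := h
  exact ⟨(exists_walk_sheetSwap p).choose⟩

theorem dist_sheetSwap {x y : V × Fin 2} (h : G.doubleCover.Reachable x y) :
    G.doubleCover.dist (sheetSwap x) (sheetSwap y) = G.doubleCover.dist x y := by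
  have key : ∀ x y : V × Fin 2, G.doubleCover.Reachable x y →
      G.doubleCover.dist (SimpleGraph.sheetSwap x) (SimpleGraph.sheetSwap y) ≤ G.doubleCover.dist x y := by
    intro x y h
    obtain ⟨p, hp⟩ := h.exists_walk_length_eq_dist
    obtain ⟨q, hq⟩ := exists_walk_sheetSwap p
    exact (dist_le q).trans_eq (hq.trans hp)
  refine le_antisymm (key x y h) ?_
  simpa only [sheetSwap_sheetSwap] using key _ _ h.sheetSwap

theorem exists_walk_fst {x y : V × Fin 2} (p : G.doubleCover.Walk x y) :
    ∃ q : G.Walk x.1 y.1, q.length = p.length := by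
  induction p with
  | nil => exact ⟨.nil, rfl⟩
  | cons h p ih =>
    obtain ⟨q, hq⟩ := ih
    exact ⟨.cons h.1 q, congrArg (· + 1) hq⟩

theorem dist_fst_le {x y : V × Fin 2} (h : G.doubleCover.Reachable x y) : G.dist x.1 y.1 ≤ G.doubleCover.dist x y := by
  obtain ⟨p, hp⟩ := h.exists_walk_length_eq_dist
  obtain ⟨q, hq⟩ := exists_walk_fst p
  exact (dist_le q).trans_eq (hq.trans hp)

theorem exists_walk_lift {u v : V} (p : G.Walk u v) (i : Fin 2) :
    ∃ (j : Fin 2) (q : G.doubleCover.Walk (u, i) (v, j)), q.length = p.length := by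
  induction p generalizing i with
  | nil => exact ⟨i, .nil, rfl⟩
  | cons h p ih =>
    obtain ⟨j, q, hq⟩ := ih i.rev
    exact ⟨j, .cons ⟨h, pathGraph_two_adj_iff.2 rfl⟩ q, congrArg (· + 1) hq⟩

/-- A lifted geodesic stays shortest because projection does not increase distances. The final sheet
`j` cannot be prescribed. -/
theorem Reachable.exists_lift {u v : V} (h : G.Reachable u v) (i : Fin 2) :
    ∃ j, G.doubleCover.Reachable (u, i) (v, j) ∧ G.doubleCover.dist (u, i) (v, j) = G.dist u v := by
  obtain ⟨p, hp⟩ := h.exists_walk_length_eq_dist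
  obtain ⟨j, q, hq⟩ := exists_walk_lift p i
  exact ⟨j, ⟨q⟩, le_antisymm ((dist_le q).trans_eq (hq.trans hp)) (dist_fst_le ⟨q⟩)⟩

theorem eq_or_eq_sheetSwap (v : V) (i j : Fin 2) : (v, j) = (v, i) ∨ (v, j) = sheetSwap (v, i) := by
  have : j = i ∨ j = i.rev := by revert i j; decide
  simpa [sheetSwap] using this

/-- If the two sheets are not joined by a path, then the double cover consists of copies of the
graph. -/
theorem FourPoint.of_not_reachable_sheetSwap {k : ℕ} (h : G.doubleCover.FourPoint k) (hconn : G.Connected)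
    (hsep : ∀ x, ¬ G.doubleCover.Reachable x (sheetSwap x)) : G.FourPoint k := by
  intro a b c e _ _ _
  obtain ⟨i, hb, -⟩ := (hconn a b).exists_lift 0
  obtain ⟨j, hc, -⟩ := (hconn a c).exists_lift 0
  obtain ⟨l, he, -⟩ := (hconn a e).exists_lift 0
  have key : ∀ x y, G.doubleCover.Reachable x y → G.doubleCover.dist x y = G.dist x.1 y.1 := by
    rintro ⟨u, i⟩ ⟨v, j⟩ huv
    obtain ⟨j', hj, hd⟩ := (hconn u v).exists_lift i
    rcases eq_or_eq_sheetSwap v j j' with h' | h'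
    -- A lift ending on the other sheet would connect a vertex to its image under the swap.
    · rw [← hd, h']
    · rw [h'] at hj
      exact (hsep _ (huv.symm.trans hj)).elim
  have h4 := h _ _ _ _ hb hc he
  rwa [key _ _ hb, key _ _ hc, key _ _ he, key _ _ (hb.symm.trans hc), key _ _ (hb.symm.trans he),
    key _ _ (hc.symm.trans he)] at h4

/-- In a double cover with the four-point condition, the middle of a geodesic between the two lifts
of a vertex is almost fixed when the sheets are exchanged. -/
theorem FourPoint.exists_dist_sheetSwap_le {k : ℕ} (h : G.doubleCover.FourPoint k) {x : V × Fin 2}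
    (hx : G.doubleCover.Reachable x (sheetSwap x)) :
    ∃ m, G.doubleCover.Reachable x m ∧ G.doubleCover.Reachable m (sheetSwap m) ∧ G.doubleCover.dist m (sheetSwap m) ≤ k + 1 := by
  obtain ⟨p, hp⟩ := hx.exists_walk_length_eq_dist
  set n := G.doubleCover.dist x (sheetSwap x) with hn
  have hm : G.doubleCover.Reachable x (p.getVert (n / 2)) := ⟨p.take _⟩
  have h1 := dist_le (p.take (n / 2))
  have h2 := dist_le (p.drop (n / 2))
  rw [Walk.take_length] at h1
  rw [Walk.drop_length] at h2
  have h3 := dist_sheetSwap hm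
  have h4 := dist_sheetSwap (hm.symm.trans hx)
  -- Four-point condition for `x, m, σ x, σ m`. Since σ is an isometry, both sums on the right are
  -- at most `2 (n - n / 2) ≤ n + 1`, while the left side is `n + d(m, σ m)`.
  have h5 := h _ _ _ _ hm hx (hx.trans hm.sheetSwap)
  refine ⟨p.getVert (n / 2), hm, hm.symm.trans (hx.trans hm.sheetSwap), ?_⟩
  rw [sheetSwap_sheetSwap] at h4
  have h6 := G.doubleCover.dist_comm (u := x) (v := sheetSwap (p.getVert (n / 2)))
  omega

/-- With base point `m`, the right side of the four-point condition involves only distances to `m`,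
known up to `k + 1`, and the distances from `b` to `a` and `c`, which lift exactly. The error is `k
+ (k + 1)`, doubled by the change of base point. -/
theorem FourPoint.of_reachable_sheetSwap {k : ℕ} (h : G.doubleCover.FourPoint k) (hconn : G.Connected)
    {x : V × Fin 2} (hx : G.doubleCover.Reachable x (sheetSwap x)) : G.FourPoint (2 * (2 * k + 1)) := by
  obtain ⟨m, hxm, hm, hmd⟩ := h.exists_dist_sheetSwap_le hx
  have hr : ∀ y, G.doubleCover.Reachable m y := by
    rintro ⟨u, j⟩
    obtain ⟨i, hi, -⟩ := (hconn m.1 u).exists_lift m.2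
    rcases eq_or_eq_sheetSwap u i j with h' | h'
    · rw [h']; exact hi
    · rw [h']; exact hm.trans hi.sheetSwap
  have hrr : ∀ y z, G.doubleCover.Reachable y z := fun y z => (hr y).symm.trans (hr z)
  -- The lift of a geodesic ends at `m` or at `σ m`, and these are at most `k + 1` apart.
  have hd : ∀ y : V × Fin 2, G.doubleCover.dist y m ≤ G.dist y.1 m.1 + (k + 1) := by
    intro y
    obtain ⟨j, hj, hd⟩ := (hconn y.1 m.1).exists_lift y.2
    rcases eq_or_eq_sheetSwap m.1 m.2 j with h' | h'
    · rw [← hd, h']; exact Nat.le_add_right _ _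
    · have h1 := (hrr y (sheetSwap m)).dist_triangle_left m
      rw [h'] at hd
      have h2 := G.doubleCover.dist_comm (u := m) (v := sheetSwap m)
      have h3 : G.doubleCover.dist y (sheetSwap m) = G.dist y.1 m.1 := hd
      omega
  refine FourPoint.of_base m.1 fun a b c => ?_
  obtain ⟨i, -, ha⟩ := (hconn b a).exists_lift 0
  obtain ⟨j, -, hc⟩ := (hconn b c).exists_lift 0
  have h1 := h (a, i) (b, 0) (c, j) m (hrr _ _) (hrr _ _) (hrr _ _)
  have h2 := dist_fst_le (hrr (a, i) (c, j))
  have h3 := dist_fst_le (hrr (b, 0) m)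
  have h4 := hd (a, i)
  have h5 := hd (c, j)
  have h6 := G.doubleCover.dist_comm (u := (a, i)) (v := (b, 0))
  have h7 := G.dist_comm (u := a) (v := b)
  dsimp only at *
  omega

theorem FourPoint.of_directProduct {k : ℕ} (h : G.doubleCover.FourPoint k) (hconn : G.Connected) :
    ∃ k', G.FourPoint k' := by
  by_cases hx : ∃ x, G.doubleCover.Reachable x (sheetSwap x)
  · obtain ⟨x, hx⟩ := hx
    exact ⟨_, h.of_reachable_sheetSwap hconn hx⟩
  · exact ⟨_, h.of_not_reachable_sheetSwap hconn (not_exists.1 hx)⟩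

end SimpleGraph

/-! ### The distance on the metric graph -/

namespace MetricGraph

variable {V : Type*} {G : SimpleGraph V}

open Classical in
/-- The point at distance `t` from `u` on the edge `u v`, in barycentric coordinates. -/
noncomputable def edgeCoord (u v : V) (t : ℝ) : V → ℝ :=
  (1 - t) • Pi.single u (1 : ℝ) + t • Pi.single v (1 : ℝ)

theorem mem_edgeSegment_iff {u v : V} {x : V → ℝ} :
    x ∈ edgeSegment u v ↔ ∃ t ∈ Set.Icc (0 : ℝ) 1, edgeCoord u v t = x := by
  rw [edgeSegment, segment_eq_image]
  rfl

theorem coord_vertex_left (u v : V) : (vertex G u).coord = edgeCoord u v 0 := by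
  simp [vertex, edgeCoord]

theorem coord_vertex_right (u v : V) : (vertex G v).coord = edgeCoord u v 1 := by
  simp [vertex, edgeCoord]

theorem abs_edgeCoord_sub_le (u v w : V) (s t : ℝ) :
    |edgeCoord u v s w - edgeCoord u v t w| ≤ |s - t| := by
  classical
  have h : edgeCoord u v s w - edgeCoord u v t w =
      (s - t) * ((Pi.single v (1 : ℝ) : V → ℝ) w - (Pi.single u (1 : ℝ) : V → ℝ) w) := by
    simp only [edgeCoord, Pi.add_apply, Pi.smul_apply, smul_eq_mul]
    ring
  rw [h, abs_mul]
  refine mul_le_of_le_one_right (abs_nonneg _) ?_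
  simp only [Pi.single_apply]
  split_ifs <;> norm_num

theorem edgeCoord_right {u v : V} (h : u ≠ v) (t : ℝ) : edgeCoord u v t v = t := by
  classical
  simp [edgeCoord, Pi.single_eq_of_ne h.symm]

theorem edist_le_of_edgeCoord {x y : MetricGraph G} {u v : V} (h : u = v ∨ G.Adj u v) {s t : ℝ}
    (hs : s ∈ Set.Icc (0 : ℝ) 1) (ht : t ∈ Set.Icc (0 : ℝ) 1) (hx : x.coord = edgeCoord u v s)
    (hy : y.coord = edgeCoord u v t) : edist x y ≤ edist s t := by
  have hxy : OnCommonEdge x y :=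
    ⟨u, v, h, mem_edgeSegment_iff.2 ⟨s, hs, hx.symm⟩, mem_edgeSegment_iff.2 ⟨t, ht, hy.symm⟩⟩
  calc edist x y ≤ stepLength x y + 0 := iInf₂_le _ (.cons hxy (.nil y))
    _ = stepLength x y := add_zero _
    _ ≤ edist s t := iSup_le fun w => by
      rw [hx, hy, edist_dist, edist_dist]
      exact ENNReal.ofReal_le_ofReal (abs_edgeCoord_sub_le u v w s t)

theorem exists_edist_vertex_le (x : MetricGraph G) : ∃ u, edist x (vertex G u) ≤ 1 := by
  obtain ⟨u, v, h, hx⟩ := x.mem_edge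
  obtain ⟨t, ht, hx⟩ := mem_edgeSegment_iff.1 hx
  refine ⟨u, (edist_le_of_edgeCoord h ht (by simp) hx.symm (coord_vertex_left u v)).trans ?_⟩
  rw [edist_dist, Real.dist_eq, sub_zero, abs_of_nonneg ht.1]
  exact ENNReal.ofReal_le_one.2 ht.2

/-- The function on the metric graph which is the graph distance from `o` at the vertices and which
is affine on the edges. -/
noncomputable def affineDist (o : V) (x : MetricGraph G) : ℝ := ∑ᶠ w, x.coord w * G.dist o w

theorem affineDist_of_coord (o : V) {x : MetricGraph G} {u v : V} {t : ℝ}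
    (hx : x.coord = edgeCoord u v t) :
    affineDist o x = (1 - t) * G.dist o u + t * G.dist o v := by
  classical
  have hsingle : ∀ (a : V) (c : ℝ) (w : V),
      c * (Pi.single a (1 : ℝ) : V → ℝ) w * G.dist o w =
        (Pi.single a (c * G.dist o a) : V → ℝ) w := by
    intro a c w
    by_cases h : w = a
    · subst h; simp
    · simp [Pi.single_eq_of_ne h]
  have hsum : ∀ (a : V) (c : ℝ), ∑ᶠ w, (Pi.single a c : V → ℝ) w = c := by
    intro a c
    rw [finsum_eq_single _ a fun w h => Pi.single_eq_of_ne (M := fun _ => ℝ) h c, Pi.single_eq_same]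
  have hfin : ∀ (a : V) (c : ℝ), (Function.support (Pi.single a c : V → ℝ)).Finite :=
    fun a c => (Set.finite_singleton a).subset Pi.support_single_subset
  rw [affineDist, hx]
  simp only [edgeCoord, Pi.add_apply, Pi.smul_apply, smul_eq_mul, add_mul]
  rw [finsum_congr fun w => by rw [hsingle, hsingle]]
  rw [finsum_add_distrib (hfin _ _) (hfin _ _), hsum, hsum]

theorem affineDist_vertex (o u : V) : affineDist o (vertex G u) = G.dist o u := by
  rw [affineDist_of_coord o (coord_vertex_left u u)]
  ring

theorem abs_dist_sub_dist_le_one (o : V) {u v : V} (h : G.Adj u v) :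
    |(G.dist o u : ℝ) - G.dist o v| ≤ 1 := by
  have h1 := h.reachable.dist_triangle_right o
  have h2 := h.symm.reachable.dist_triangle_right o
  rw [SimpleGraph.dist_eq_one_iff_adj.2 h] at h1
  rw [SimpleGraph.dist_eq_one_iff_adj.2 h.symm] at h2
  rify at h1 h2
  exact abs_le.2 ⟨by linarith, by linarith⟩

theorem edist_affineDist_le_stepLength (o : V) {x y : MetricGraph G} (h : OnCommonEdge x y) :
    edist (affineDist o x) (affineDist o y) ≤ stepLength x y := by
  obtain ⟨u, v, huv, hx, hy⟩ := h
  obtain ⟨s, -, hx⟩ := mem_edgeSegment_iff.1 hx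
  obtain ⟨t, -, hy⟩ := mem_edgeSegment_iff.1 hy
  rw [affineDist_of_coord o hx.symm, affineDist_of_coord o hy.symm]
  rcases huv with rfl | huv
  · simp [← add_mul]
  · refine le_trans ?_ (le_iSup (fun w => edist (x.coord w) (y.coord w)) v)
    rw [← hx, ← hy, edgeCoord_right huv.ne, edgeCoord_right huv.ne, edist_dist, edist_dist]
    refine ENNReal.ofReal_le_ofReal ?_
    have h : (1 - s) * (G.dist o u : ℝ) + s * G.dist o v -
        ((1 - t) * G.dist o u + t * G.dist o v) = -((s - t) * (G.dist o u - G.dist o v)) := by ring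
    rw [Real.dist_eq, Real.dist_eq, h, abs_neg, abs_mul]
    exact mul_le_of_le_one_right (abs_nonneg _) (abs_dist_sub_dist_le_one o huv)

theorem edist_affineDist_le (o : V) (x y : MetricGraph G) :
    edist (affineDist o x) (affineDist o y) ≤ edist x y := by
  refine le_iInf₂ fun r p => ?_
  induction p with
  | nil x => simp
  | cons h p ih =>
    exact (edist_triangle _ _ _).trans (add_le_add (edist_affineDist_le_stepLength o h) ih)

/-- `affineDist u` is 1-Lipschitz on the metric graph, so shortcuts through edge interiors gain
nothing. -/
theorem dist_le_edist_vertex (u v : V) :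
    (G.dist u v : ℝ≥0∞) ≤ edist (vertex G u) (vertex G v) := by
  refine le_trans (le_of_eq ?_) (edist_affineDist_le u (vertex G u) (vertex G v))
  rw [affineDist_vertex, affineDist_vertex, SimpleGraph.dist_self, edist_dist, Real.dist_eq]
  simp

end MetricGraph

/-! ### Shortest walks as geodesics of the metric graph -/

namespace SimpleGraph.Walk

open MetricGraph

variable {V : Type*} {G : SimpleGraph V} {u v : V}

theorem getVert_eq_or_adj (p : G.Walk u v) (i : ℕ) :
    p.getVert i = p.getVert (i + 1) ∨ G.Adj (p.getVert i) (p.getVert (i + 1)) := by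
  rcases lt_or_ge i p.length with h | h
  · exact Or.inr (p.adj_getVert_succ h)
  · exact Or.inl (by rw [p.getVert_of_length_le h, p.getVert_of_length_le (by omega)])

/-- The parametrization of a walk by arc length, as a path in the metric graph. -/
noncomputable def arcPath (p : G.Walk u v) (t : ℝ) : MetricGraph G :=
  ⟨edgeCoord (p.getVert ⌊t⌋₊) (p.getVert (⌊t⌋₊ + 1)) (Int.fract t),
    _, _, p.getVert_eq_or_adj ⌊t⌋₊,
    mem_edgeSegment_iff.2 ⟨_, ⟨Int.fract_nonneg t, (Int.fract_lt_one t).le⟩, rfl⟩⟩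

theorem arcPath_natCast (p : G.Walk u v) (i : ℕ) : p.arcPath i = vertex G (p.getVert i) := by
  have h : (p.arcPath i).coord = (vertex G (p.getVert i)).coord := by
    rw [coord_vertex_left _ (p.getVert (i + 1))]
    simp [arcPath]
  revert h
  cases p.arcPath i
  cases vertex G (p.getVert i)
  rintro rfl
  rfl

theorem coord_arcPath (p : G.Walk u v) {i : ℕ} {t : ℝ} (h₁ : (i : ℝ) ≤ t) (h₂ : t ≤ i + 1) :
    (p.arcPath t).coord = edgeCoord (p.getVert i) (p.getVert (i + 1)) (t - i) := by
  -- At `t = i + 1` the floor jumps to the next edge, so this endpoint is treated separately.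
  rcases h₂.eq_or_lt with rfl | h₂
  · have := p.arcPath_natCast (i + 1)
    push_cast at this
    rw [this, coord_vertex_right (p.getVert i), add_sub_cancel_left]
  · have ht : (0 : ℝ) ≤ t := (Nat.cast_nonneg i).trans h₁
    have hfl : ⌊t⌋₊ = i := (Nat.floor_eq_iff ht).2 ⟨h₁, h₂⟩
    have hfr : Int.fract t = t - i := by
      rw [Int.fract, ← natCast_floor_eq_intCast_floor ht, hfl]
    simp only [arcPath, hfl, hfr]

theorem edist_arcPath_le_of_mem (p : G.Walk u v) {i : ℕ} {s t : ℝ} (hs : s ∈ Set.Icc (i : ℝ) (i + 1))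
    (ht : t ∈ Set.Icc (i : ℝ) (i + 1)) : EDist.edist (p.arcPath s) (p.arcPath t) ≤ EDist.edist s t := by
  have h : ∀ r ∈ Set.Icc (i : ℝ) (i + 1), r - i ∈ Set.Icc (0 : ℝ) 1 :=
    fun r hr => ⟨by linarith [hr.1], by linarith [hr.2]⟩
  simpa using edist_le_of_edgeCoord (p.getVert_eq_or_adj i) (h s hs) (h t ht)
    (p.coord_arcPath hs.1 hs.2) (p.coord_arcPath ht.1 ht.2)

theorem edist_arcPath_le (p : G.Walk u v) {s t : ℝ} (hs : 0 ≤ s) (hst : s ≤ t) :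
    EDist.edist (p.arcPath s) (p.arcPath t) ≤ ENNReal.ofReal (t - s) := by
  have hre : ∀ {a b : ℝ}, a ≤ b → EDist.edist a b = ENNReal.ofReal (b - a) := fun {a b} hab => by
    rw [PseudoEMetricSpace.edist_comm, _root_.edist_dist, Real.dist_eq, abs_of_nonneg (sub_nonneg.2 hab)]
  have key : ∀ (n : ℕ) (t : ℝ), s ≤ t → t ≤ n →
      EDist.edist (p.arcPath s) (p.arcPath t) ≤ ENNReal.ofReal (t - s) := by
    intro n
    induction n with
    | zero =>
      intro t h1 h2
      have : s = t := le_antisymm h1 (h2.trans (by simpa using hs))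
      simp [this]
    | succ n ih =>
      intro t h1 h2
      push_cast at h2
      rcases le_total t n with h3 | h3
      · exact ih t h1 h3
      · rcases le_total s n with h4 | h4
        · refine (PseudoEMetricSpace.edist_triangle _ (p.arcPath n) _).trans ?_
          have h5 := p.edist_arcPath_le_of_mem (i := n) (s := n) (t := t) ⟨le_rfl, by linarith⟩ ⟨h3, h2⟩
          refine (add_le_add (ih n h4 le_rfl) h5).trans ?_
          rw [hre h3, ← ENNReal.ofReal_add (by linarith) (by linarith)]
          exact ENNReal.ofReal_le_ofReal (by linarith)
        · rw [← hre h1]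
          exact p.edist_arcPath_le_of_mem (i := n) ⟨h4, by linarith⟩ ⟨h3, h2⟩
  obtain ⟨n, hn⟩ := exists_nat_ge t
  exact key n t hst hn

/-- If one piece could be shortened, the triangle inequality would bring the endpoints closer than
`G.dist u v`. -/
theorem edist_arcPath_eq {p : G.Walk u v} (hp : p.length = G.dist u v) {s t : ℝ} (hs : 0 ≤ s)
    (hst : s ≤ t) (ht : t ≤ p.length) :
    EDist.edist (p.arcPath s) (p.arcPath t) = ENNReal.ofReal (t - s) := by
  refine le_antisymm (p.edist_arcPath_le hs hst) ?_
  have h1 := p.edist_arcPath_le le_rfl hs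
  have h2 := p.edist_arcPath_le (hs.trans hst) ht
  have h3 := dist_le_edist_vertex (G := G) u v
  have h4 : vertex G u = p.arcPath 0 := by
    have := p.arcPath_natCast 0
    rw [p.getVert_zero] at this
    exact_mod_cast this.symm
  have h5 : vertex G v = p.arcPath p.length := by rw [p.arcPath_natCast, p.getVert_length]
  rw [← hp, h4, h5] at h3
  have h6 := (PseudoEMetricSpace.edist_triangle (p.arcPath 0) (p.arcPath s) (p.arcPath p.length)).trans
    (add_le_add h1 ((PseudoEMetricSpace.edist_triangle _ (p.arcPath t) _).trans (add_le_add_right h2 _)))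
  have h7 := h3.trans h6
  by_contra! hlt
  have h8 : ENNReal.ofReal (s - 0) + (EDist.edist (p.arcPath s) (p.arcPath t) +
      ENNReal.ofReal (p.length - t)) < ENNReal.ofReal (s - 0) + (ENNReal.ofReal (t - s) +
      ENNReal.ofReal (p.length - t)) :=
    ENNReal.add_lt_add_left ENNReal.ofReal_ne_top
      (ENNReal.add_lt_add_right ENNReal.ofReal_ne_top hlt)
  refine absurd (h7.trans_lt h8) (not_lt.2 (le_of_eq ?_))
  rw [← ENNReal.ofReal_add (by linarith) (by linarith),
    ← ENNReal.ofReal_add (by linarith) (by linarith), ← ENNReal.ofReal_natCast]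
  congr 1
  ring

/-- A walk of minimal length is a geodesic of the metric graph. -/
theorem isGeodesic {p : G.Walk u v} (hp : p.length = G.dist u v) :
    IsGeodesic (vertex G u) (vertex G v) (p.arcPath '' Set.Icc 0 (p.length : ℝ)) := by
  refine ⟨p.length, p.arcPath, Nat.cast_nonneg _, ?_, ?_, ?_, rfl⟩
  · simpa using p.arcPath_natCast 0
  · rw [p.arcPath_natCast, p.getVert_length]
  · have key : ∀ s ∈ Set.Icc 0 (p.length : ℝ), ∀ t ∈ Set.Icc 0 (p.length : ℝ), s ≤ t →
        EDist.edist (p.arcPath s) (p.arcPath t) = EDist.edist s t := by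
      intro s hs t ht hst
      rw [edist_arcPath_eq hp hs.1 hst ht.2, PseudoEMetricSpace.edist_comm s t, _root_.edist_dist, Real.dist_eq,
        abs_of_nonneg (sub_nonneg.2 hst)]
    intro s hs t ht
    rcases le_total s t with hst | hst
    · exact key s hs t ht hst
    · rw [PseudoEMetricSpace.edist_comm, key t ht s hs hst, PseudoEMetricSpace.edist_comm]

end SimpleGraph.Walk

/-! ### From thin triangles to thin triangles of vertices -/

namespace MetricGraph

variable {V : Type*} {G : SimpleGraph V}

theorem edist_vertex {u v : V} (h : G.Reachable u v) :
    edist (vertex G u) (vertex G v) = G.dist u v := by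
  obtain ⟨p, hp⟩ := h.exists_walk_length_eq_dist
  have := SimpleGraph.Walk.edist_arcPath_eq hp le_rfl (Nat.cast_nonneg _) le_rfl
  have h0 := p.arcPath_natCast 0
  rw [p.arcPath_natCast, p.getVert_length] at this
  rw [Nat.cast_zero, p.getVert_zero] at h0
  rw [h0, sub_zero, ENNReal.ofReal_natCast, hp] at this
  exact this

/-- If the metric graph is hyperbolic, then geodesic triangles of vertices are thin. -/
theorem vertexThin_of_isDeltaHyperbolic {δ : ℝ≥0} (h : IsDeltaHyperbolic (MetricGraph G) δ) :
    G.VertexThin (⌈δ⌉₊ + 2) := by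
  intro x y z u hy hz hu hb
  obtain ⟨p₁, hp₁⟩ := hu.exists_walk_length_eq_dist
  obtain ⟨p₂, hp₂⟩ := (hu.symm.trans hy).exists_walk_length_eq_dist
  obtain ⟨q, hq⟩ := (hy.symm.trans hz).exists_walk_length_eq_dist
  obtain ⟨r, hr⟩ := hz.symm.exists_walk_length_eq_dist
  -- The side from `x` to `y` is chosen to pass through `u`.
  have hp : (p₁.append p₂).length = G.dist x y := by rw [SimpleGraph.Walk.length_append, hp₁, hp₂, hb]
  have hthin := (h _ _ _ _ _ _ ⟨SimpleGraph.Walk.isGeodesic hp, SimpleGraph.Walk.isGeodesic hq, SimpleGraph.Walk.isGeodesic hr⟩).1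
    (vertex G u) ⟨p₁.length, ⟨Nat.cast_nonneg _, by simp⟩, by
      rw [SimpleGraph.Walk.arcPath_natCast, SimpleGraph.Walk.getVert_append]; simp⟩
  -- The infimum need not be attained, which costs 1; rounding down to a vertex on the other side
  -- costs another 1.
  have hlt : Metric.infEDist (vertex G u) (q.arcPath '' Set.Icc 0 (q.length : ℝ) ∪
      r.arcPath '' Set.Icc 0 (r.length : ℝ)) < δ + 1 :=
    hthin.trans_lt (ENNReal.lt_add_right ENNReal.coe_ne_top one_ne_zero)
  have key : ∀ {a b : V} (p : G.Walk a b) {t : ℝ}, 0 ≤ t →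
      edist (vertex G u) (p.arcPath t) < δ + 1 → G.dist u (p.getVert ⌊t⌋₊) ≤ ⌈δ⌉₊ + 2 := by
    intro a b p t ht hlt
    have h1 := p.edist_arcPath_le (Nat.cast_nonneg ⌊t⌋₊) (Nat.floor_le ht)
    rw [edist_comm, p.arcPath_natCast] at h1
    have h2 : ENNReal.ofReal (t - ⌊t⌋₊) ≤ 1 :=
      ENNReal.ofReal_le_one.2 (by linarith [Nat.lt_floor_add_one t])
    have h3 := (dist_le_edist_vertex _ _).trans (edist_triangle (vertex G u) (p.arcPath t)
      (vertex G (p.getVert ⌊t⌋₊)))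
    have h4 : (δ : ℝ≥0∞) ≤ (⌈δ⌉₊ : ℕ) := by exact_mod_cast Nat.le_ceil δ
    have h5 : (G.dist u (p.getVert ⌊t⌋₊) : ℝ≥0∞) ≤ ((⌈δ⌉₊ + 2 : ℕ) : ℝ≥0∞) := by
      refine h3.trans ((add_le_add hlt.le (h1.trans h2)).trans ?_)
      push_cast
      rw [add_assoc, one_add_one_eq_two]
      gcongr
    exact_mod_cast h5
  obtain ⟨y', hy', hlt⟩ := Metric.infEDist_lt_iff.1 hlt
  rcases hy' with ⟨t, ht, rfl⟩ | ⟨t, ht, rfl⟩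
  · exact ⟨_, hy.trans ⟨q.take ⌊t⌋₊⟩, key q ht.1 hlt, Or.inl (q.dist_getVert_add hq _)⟩
  · refine ⟨_, hz.trans ⟨r.take ⌊t⌋₊⟩, key r ht.1 hlt, Or.inr ?_⟩
    have := r.dist_getVert_add hr ⌊t⌋₊
    rw [G.dist_comm (u := x) (v := z), G.dist_comm (u := x), G.dist_comm (v := z)]
    omega

end MetricGraph

/-! ### From the four-point condition to thin triangles -/

/-- The four-point condition for a space with finite distances. -/
structure FourPointSpace (X : Type*) [PseudoEMetricSpace X] (K : ℝ≥0) : Prop where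
  edist_ne_top : ∀ x y : X, edist x y ≠ ⊤
  fourPoint : ∀ a b c e : X, (edist a c).toReal + (edist b e).toReal ≤
    max ((edist a b).toReal + (edist c e).toReal) ((edist b c).toReal + (edist a e).toReal) + K

section

variable {X : Type*} [PseudoEMetricSpace X] {K : ℝ≥0}

/-- The points of a geodesic, described by their distances to the endpoints. -/
theorem IsGeodesic.exists_length {x y : X} {S : Set X} (h : IsGeodesic x y S) :
    ∃ γ : ℝ → X, S = γ '' Set.Icc 0 (edist x y).toReal ∧
      ∀ t ∈ Set.Icc 0 (edist x y).toReal, (edist x (γ t)).toReal = t ∧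
        (edist (γ t) y).toReal = (edist x y).toReal - t := by
  obtain ⟨L, γ, hL, rfl, rfl, hγ, rfl⟩ := h
  have key : ∀ s ∈ Set.Icc 0 L, ∀ t ∈ Set.Icc 0 L, s ≤ t → (edist (γ s) (γ t)).toReal = t - s := by
    intro s hs t ht hst
    rw [hγ s hs t ht, edist_dist, ENNReal.toReal_ofReal dist_nonneg, dist_comm, Real.dist_eq,
      abs_of_nonneg (sub_nonneg.2 hst)]
  have h0 : (0 : ℝ) ∈ Set.Icc 0 L := ⟨le_rfl, hL⟩
  have h1 : L ∈ Set.Icc 0 L := ⟨hL, le_rfl⟩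
  have hd : (edist (γ 0) (γ L)).toReal = L := by rw [key 0 h0 L h1 hL, sub_zero]
  rw [hd]
  exact ⟨γ, rfl, fun t ht => ⟨by rw [key 0 h0 t ht ht.1, sub_zero], key t ht L h1 ht.2⟩⟩

/-- In a space with the four-point condition, a point which is almost between `y` and `z` is close
to every geodesic joining `y` and `z`. -/
theorem FourPointSpace.exists_mem_geodesic (h : FourPointSpace X K) {y z p : X} {S : Set X}
    (hS : IsGeodesic y z S)
    (hp : (edist y p).toReal + (edist p z).toReal ≤ (edist y z).toReal + K) :
    ∃ r ∈ S, (edist p r).toReal ≤ 2 * K := by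
  obtain ⟨γ, rfl, hγ⟩ := hS.exists_length
  have hK : (0 : ℝ) ≤ K := K.2
  rcases le_total (edist y p).toReal (edist y z).toReal with hle | hle
  · have hmem : (edist y p).toReal ∈ Set.Icc 0 (edist y z).toReal := ⟨ENNReal.toReal_nonneg, hle⟩
    obtain ⟨h1, h2⟩ := hγ _ hmem
    refine ⟨_, ⟨_, hmem, rfl⟩, ?_⟩
    -- The chosen point `r` has `d(y, r) = d(y, p)`. The first alternative gives `d(p, r) ≤ K`; the
    -- second uses `hp` once more and gives `2K`.
    have h3 := h.fourPoint y p z (γ (edist y p).toReal)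
    rw [edist_comm z, h1, h2] at h3
    rcases max_cases ((edist y p).toReal + ((edist y z).toReal - (edist y p).toReal))
      ((edist p z).toReal + (edist y p).toReal) with hm | hm <;> linarith
  · have hmem : (edist y z).toReal ∈ Set.Icc 0 (edist y z).toReal := ⟨ENNReal.toReal_nonneg, le_rfl⟩
    obtain ⟨-, h2⟩ := hγ _ hmem
    refine ⟨_, ⟨_, hmem, rfl⟩, ?_⟩
    have h3 := ENNReal.toReal_mono (ENNReal.add_ne_top.2 ⟨h.edist_ne_top _ _, h.edist_ne_top _ _⟩)
      (edist_triangle p z (γ (edist y z).toReal))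
    rw [ENNReal.toReal_add (h.edist_ne_top _ _) (h.edist_ne_top _ _), edist_comm z, h2] at h3
    linarith

/-- For `p` between `x` and `y`, the four-point condition for `x, p, y, z` says that `p` is also
almost between `y` and `z`, or almost between `x` and `z`. -/
theorem FourPointSpace.infEDist_le (h : FourPointSpace X K) {x y z : X} {A B C : Set X}
    (ht : IsGeodesicTriangle x y z A B C) {p : X} (hp : p ∈ A) :
    Metric.infEDist p (B ∪ C) ≤ (2 * K : ℝ≥0) := by
  obtain ⟨γ, rfl, hγ⟩ := ht.side_xy.exists_length
  obtain ⟨t, htm, rfl⟩ := hp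
  obtain ⟨h1, h2⟩ := hγ t htm
  suffices ∃ r ∈ B ∪ C, (edist (γ t) r).toReal ≤ 2 * K by
    obtain ⟨r, hr, hd⟩ := this
    refine (Metric.infEDist_le_edist_of_mem hr).trans ?_
    rw [← ENNReal.ofReal_toReal (h.edist_ne_top (γ t) r), ← ENNReal.ofReal_coe_nnreal]
    exact ENNReal.ofReal_le_ofReal (by simpa using hd)
  have h3 := h.fourPoint x (γ t) y z
  rcases le_max_iff.1 (sub_le_iff_le_add.2 h3) with h4 | h4
  · obtain ⟨r, hr, hd⟩ := h.exists_mem_geodesic ht.side_yz (p := γ t) (by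
      rw [edist_comm y (γ t)]; linarith)
    exact ⟨r, Or.inl hr, hd⟩
  · obtain ⟨r, hr, hd⟩ := h.exists_mem_geodesic ht.side_zx (p := γ t) (by
      rw [edist_comm z x, edist_comm z (γ t), edist_comm (γ t) x]; linarith)
    exact ⟨r, Or.inr hr, hd⟩

/-- The four-point condition implies that geodesic triangles are thin. -/
theorem FourPointSpace.isDeltaHyperbolic (h : FourPointSpace X K) :
    IsDeltaHyperbolic X (2 * K) := by
  intro x y z A B C ht
  exact ⟨fun p hp => h.infEDist_le ht hp,
    fun p hp => h.infEDist_le ⟨ht.side_yz, ht.side_zx, ht.side_xy⟩ hp,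
    fun p hp => h.infEDist_le ⟨ht.side_zx, ht.side_xy, ht.side_yz⟩ hp⟩

end

/-! ### Four-point condition from vertices to the whole metric graph -/

namespace MetricGraph

variable {V : Type*} {G : SimpleGraph V}

theorem edist_ne_top (hconn : G.Connected) (x y : MetricGraph G) : edist x y ≠ ⊤ := by
  obtain ⟨u, hu⟩ := exists_edist_vertex_le x
  obtain ⟨v, hv⟩ := exists_edist_vertex_le y
  rw [edist_comm] at hv
  have h := (edist_triangle4 x (vertex G u) (vertex G v) y)
  rw [edist_vertex (hconn u v)] at h
  exact ne_top_of_le_ne_top (ENNReal.add_ne_top.2 ⟨ENNReal.add_ne_top.2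
    ⟨ne_top_of_le_ne_top ENNReal.one_ne_top hu, ENNReal.natCast_ne_top _⟩,
    ne_top_of_le_ne_top ENNReal.one_ne_top hv⟩) h

theorem abs_toReal_edist_sub_dist_le (hconn : G.Connected) {x y : MetricGraph G} {u v : V}
    (hu : edist x (vertex G u) ≤ 1) (hv : edist y (vertex G v) ≤ 1) :
    |(edist x y).toReal - G.dist u v| ≤ 2 := by
  have hf := edist_ne_top hconn
  have tri : ∀ a b c : MetricGraph G,
      (edist a c).toReal ≤ (edist a b).toReal + (edist b c).toReal := by
    intro a b c
    rw [← ENNReal.toReal_add (hf _ _) (hf _ _)]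
    exact ENNReal.toReal_mono (ENNReal.add_ne_top.2 ⟨hf _ _, hf _ _⟩) (edist_triangle a b c)
  have h1 : (edist x (vertex G u)).toReal ≤ 1 := ENNReal.toReal_mono ENNReal.one_ne_top hu
  have h2 : (edist y (vertex G v)).toReal ≤ 1 := ENNReal.toReal_mono ENNReal.one_ne_top hv
  have h3 : (edist (vertex G u) (vertex G v)).toReal = G.dist u v := by
    rw [edist_vertex (hconn u v), ENNReal.toReal_natCast]
  have h4 := tri x (vertex G u) y
  have h5 := tri (vertex G u) (vertex G v) y
  have h6 := tri (vertex G u) x (vertex G v)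
  have h7 := tri x y (vertex G v)
  rw [edist_comm (vertex G v) y] at h5
  rw [edist_comm (vertex G u) x] at h6
  rw [← h3]
  exact abs_le.2 ⟨by linarith, by linarith⟩

/-- Replacing points by vertices within distance 1 changes each distance by at most 2. Two distances
on the left and two on the right give the 8. -/
theorem fourPointSpace (hconn : G.Connected) {k : ℕ} (h : G.FourPoint k) :
    FourPointSpace (MetricGraph G) (k + 8) := by
  refine ⟨edist_ne_top hconn, fun a b c e => ?_⟩
  obtain ⟨a', ha⟩ := exists_edist_vertex_le a
  obtain ⟨b', hb⟩ := exists_edist_vertex_le b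
  obtain ⟨c', hc⟩ := exists_edist_vertex_le c
  obtain ⟨e', he⟩ := exists_edist_vertex_le e
  have h0 := h a' b' c' e' (hconn _ _) (hconn _ _) (hconn _ _)
  have h1 := abs_le.1 (abs_toReal_edist_sub_dist_le hconn ha hc)
  have h2 := abs_le.1 (abs_toReal_edist_sub_dist_le hconn hb he)
  have h3 := abs_le.1 (abs_toReal_edist_sub_dist_le hconn ha hb)
  have h4 := abs_le.1 (abs_toReal_edist_sub_dist_le hconn hc he)
  have h5 := abs_le.1 (abs_toReal_edist_sub_dist_le hconn hb hc)
  have h6 := abs_le.1 (abs_toReal_edist_sub_dist_le hconn ha he)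
  push_cast
  rw [← max_add_add_right, le_max_iff] at h0 ⊢
  rcases h0 with h0 | h0
  · left
    rify at h0
    linarith
  · right
    rify at h0
    linarith

end MetricGraph

theorem mainTheorem4 {V : Type*} (G₁ : SimpleGraph V) (hconn : G₁.Connected)
    (hG₁ : ¬ IsHyperbolicGraph G₁) :
    ¬ IsHyperbolicGraph (directProduct G₁ (SimpleGraph.pathGraph 2)) := by
  rintro ⟨δ, hδ⟩
  obtain ⟨k, hk⟩ :=
    (MetricGraph.vertexThin_of_isDeltaHyperbolic hδ).fourPoint.of_directProduct hconn
  exact hG₁ ⟨_, (MetricGraph.fourPointSpace hconn hk).isDeltaHyperbolic⟩
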